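/- Let $\lambda\in i\mathbb{R}$, and let $\pi_\lambda$ be the corresponding representation of $PGL_2(\mathbb{R})$ in the line model: $V_\lambda$ consists of the restrictions $v(x)=f(x,1)$ of smooth functions $f$ on $\mathbb{R}^2\setminus\{0\}$ with $f(cu)=|c|^{\lambda-1}f(u)$ for $c\in\mathbb{R}\setminus\{0\}$, and $g$ acts by $(\pi_\lambda(g)f)(u)=|\det g|^{(\lambda-1)/2}f(g^{-1}u)$. For an integer $m$ let $e_m(x)=e^{im\arctan x}(1+x^2)^{\frac{\lambda-1}{2}}$ (for even $m$ this is a $K$-type vector in $V_\lambda$; for odd $m$ the same formulas are used). For real $n>0$ let $\psi_n(x)=e^{inx}$, and let the model Whittaker functional be $$\langle v,\mathcal{W}^{\rm mod}_n\rangle=\frac1\pi\int_{\mathbb{R}}v(x)\,\overline{\psi_n(x)}\,dx ,$$ understood as an improper (conditionally convergent) integral. For $a>0$ let $[a]={\rm diag}(a,a^{-1})$, so that $(\pi_\lambda([a])v)(x)=a^{\lambda-1}v(a^{-2}x)$. Then there are constants $C>0$ and $M$, depending only on $\lambda$, such that the following holds. Let $m\ge M$ be a positive integer, let $n>0$ be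 real and $0<a\le 1$, and suppose that $\beta=(m/n)^{1/2}\le 1$ and that $\varepsilon=a/\beta-1$ satisfies $$0\le\varepsilon\le (n\beta^2)^{-2/3}\le \tfrac12 .$$ Then the integral defining $\langle\pi_\lambda([a])e_m,\mathcal{W}^{\rm mod}_n\rangle$ converges and $$\big|\langle\pi_\lambda([a])e_m,\mathcal{W}^{\rm mod}_n\rangle\big|^2\ \ge\ C\, n^{-2/3}\beta^{2/3}.$$ -/

import Mathlib

open Filter Topology
open scoped ContDiff

noncomputable section

namespace PrincipalSeries

/-- The action of `g ∈ GL₂(ℝ)` on functions on the plane: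
`(π_lam(g) f)(v) = |det g| ^ ((lam - 1) / 2) * f (g⁻¹ v)`. On even functions that are homogeneous of
degree `lam - 1` the centre acts trivially, so there it is an action of `PGL₂(ℝ)`. -/
def planeAction (lam : ℂ) (g : GL (Fin 2) ℝ) (f : (Fin 2 → ℝ) → ℂ) : (Fin 2 → ℝ) → ℂ :=
  fun v => ((|(g : Matrix (Fin 2) (Fin 2) ℝ).det| : ℝ) : ℂ) ^ ((lam - 1) / 2) *
    f (((g⁻¹ : GL (Fin 2) ℝ) : Matrix (Fin 2) (Fin 2) ℝ).mulVec v)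

/-- The space `W_lam`: smooth even homogeneous functions of degree `lam - 1` on the punctured plane. -/
structure IsPlaneVector (lam : ℂ) (f : (Fin 2 → ℝ) → ℂ) : Prop where
  smooth : ContDiffOn ℝ ∞ f {0}ᶜ
  homogeneous : ∀ c : ℝ, c ≠ 0 → ∀ v : Fin 2 → ℝ, v ≠ 0 →
    f (c • v) = ((|c| : ℝ) : ℂ) ^ (lam - 1) * f v

/-- Restriction to the line `{(x, 1)}`. -/
def restrictLine (f : (Fin 2 → ℝ) → ℂ) : ℝ → ℂ := fun x => f ![x, 1]

/-- The line model `V_lam`: the restrictions to the line of the elements of `W_lam`. -/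
def IsLineVector (lam : ℂ) (v : ℝ → ℂ) : Prop :=
  ∃ f : (Fin 2 → ℝ) → ℂ, IsPlaneVector lam f ∧ restrictLine f = v

/-- The even homogeneous function of degree `lam - 1` on the punctured plane with given restriction
to the line `{(x, 1)}`; its values on the horizontal axis are limits of the others. -/
def homExtend (lam : ℂ) (v : ℝ → ℂ) : (Fin 2 → ℝ) → ℂ :=
  fun p =>
    if p 1 = 0 then
      ((|p 0| : ℝ) : ℂ) ^ (lam - 1) *
        limUnder atTop (fun t : ℝ => ((|t| : ℝ) : ℂ) ^ (1 - lam) * v t)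
    else ((|p 1| : ℝ) : ℂ) ^ (lam - 1) * v (p 0 / p 1)

/-- The action `π_lam` in the line model. -/
def lineAction (lam : ℂ) (g : GL (Fin 2) ℝ) (v : ℝ → ℂ) : ℝ → ℂ :=
  restrictLine (planeAction lam g (homExtend lam v))

/-- The matrix `[a] = diag(a, a⁻¹)`. -/
def diagElement (a : ℝ) (ha : a ≠ 0) : GL (Fin 2) ℝ :=
  Matrix.GeneralLinearGroup.mkOfDetNeZero !![a, 0; 0, a⁻¹]
    (by simp [Matrix.det_fin_two, ha])

/-- The vector `e_m(x) = e ^ (i m arctan x) (1 + x²) ^ ((lam - 1) / 2)` of the line model. -/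
def kType (lam : ℂ) (m : ℤ) : ℝ → ℂ :=
  fun x => Complex.exp (Complex.I * (m : ℂ) * (Real.arctan x : ℂ)) *
    ((1 + x ^ 2 : ℝ) : ℂ) ^ ((lam - 1) / 2)

/-- The character `ψ_n(x) = e ^ (i n x)` of `N ≃ ℝ`. -/
def psi (n x : ℝ) : ℂ := Complex.exp (Complex.I * (n : ℂ) * (x : ℂ))

/-- The truncated integral `π⁻¹ ∫_p^q v(x) conj(ψ_n(x)) dx`. -/
def whittakerTrunc (n : ℝ) (v : ℝ → ℂ) (p q : ℝ) : ℂ :=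
  (Real.pi : ℂ)⁻¹ * ∫ x in p..q, v x * (starRingEnd ℂ) (psi n x)

/-- The improper integral `π⁻¹ ∫_ℝ v(x) conj(ψ_n(x)) dx` (limits at the two ends taken
independently) converges. -/
def WhittakerConverges (n : ℝ) (v : ℝ → ℂ) : Prop :=
  ∃ w : ℂ, Tendsto (fun p : ℝ × ℝ => whittakerTrunc n v p.1 p.2) (atBot ×ˢ atTop) (𝓝 w)

/-- The model Whittaker functional: the value of the improper integral
`π⁻¹ ∫_ℝ v(x) conj(ψ_n(x)) dx`. -/
def whittaker (n : ℝ) (v : ℝ → ℂ) : ℂ :=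
  limUnder (atBot ×ˢ atTop) (fun p : ℝ × ℝ => whittakerTrunc n v p.1 p.2)

theorem homExtend_restrictLine {lam : ℂ} {f : (Fin 2 → ℝ) → ℂ} (hf : IsPlaneVector lam f)
    {p : Fin 2 → ℝ} (hp : p ≠ 0) : homExtend lam (restrictLine f) p = f p := by
  unfold homExtend restrictLine
  split_ifs with h
  · have h0 : p 0 ≠ 0 := by
      intro h0
      exact hp (by ext i; fin_cases i <;> simp [h, h0])
    have hne : (![1, 0] : Fin 2 → ℝ) ≠ 0 := fun hh => one_ne_zero (congrFun hh 0)
    have hlim : Tendsto (fun t : ℝ => ((|t| : ℝ) : ℂ) ^ (1 - lam) * f ![t, 1]) atTop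
        (𝓝 (f ![1, 0])) := by
      have hc : ContinuousAt f ![1, 0] :=
        (hf.smooth.continuousOn).continuousAt (isOpen_compl_singleton.mem_nhds hne)
      have ht : Tendsto (fun t : ℝ => (![1, t⁻¹] : Fin 2 → ℝ)) atTop (𝓝 ![1, 0]) := by
        rw [tendsto_pi_nhds]
        intro i
        fin_cases i
        · simp
        · simpa using tendsto_inv_atTop_zero
      refine (hc.tendsto.comp ht).congr' ?_
      filter_upwards [eventually_gt_atTop (0 : ℝ)] with t ht
      have hv : (![1, t⁻¹] : Fin 2 → ℝ) ≠ 0 := fun hh => one_ne_zero (congrFun hh 0)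
      have h2 : (![t, 1] : Fin 2 → ℝ) = t • ![1, t⁻¹] := by
        ext i; fin_cases i <;> simp [ht.ne']
      have htc : ((|t| : ℝ) : ℂ) ≠ 0 := by simpa using ht.ne'
      rw [Function.comp_apply, h2, hf.homogeneous t ht.ne' _ hv, ← mul_assoc,
        ← Complex.cpow_add _ _ htc]
      simp
    rw [hlim.limUnder_eq, ← hf.homogeneous _ h0 _ hne]
    congr 1
    ext i; fin_cases i <;> simp [h]
  · have hv : (![p 0 / p 1, 1] : Fin 2 → ℝ) ≠ 0 := fun hh => one_ne_zero (congrFun hh 1)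
    rw [← hf.homogeneous _ h _ hv]
    congr 1
    ext i; fin_cases i <;> simp
    field_simp

/-- On `V_lam` the action `lineAction` is the one carried over from `W_lam` by restriction. -/
theorem lineAction_restrictLine {lam : ℂ} {f : (Fin 2 → ℝ) → ℂ} (hf : IsPlaneVector lam f)
    (g : GL (Fin 2) ℝ) :
    lineAction lam g (restrictLine f) = restrictLine (planeAction lam g f) := by
  ext x
  unfold lineAction
  simp only [restrictLine, planeAction]
  congr 1
  refine homExtend_restrictLine hf ?_
  intro h0
  have h1 := congrArg ((g : Matrix (Fin 2) (Fin 2) ℝ).mulVec) h0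
  rw [Matrix.mulVec_mulVec, ← Units.val_mul, mul_inv_cancel] at h1
  have := congrFun h1 1
  simp at this

/-- For even `m` the function `e_m` is an element of the line model. -/
theorem kType_isLineVector (lam : ℂ) {m : ℤ} (hm : Even m) : IsLineVector lam (kType lam m) := by
  obtain ⟨k, rfl⟩ := hm
  have hz : ∀ p : Fin 2 → ℝ, p ≠ 0 → (p 0) ^ 2 + (p 1) ^ 2 ≠ 0 := by
    intro p hp h
    apply hp
    have h0 : p 0 = 0 := by nlinarith [sq_nonneg (p 0), sq_nonneg (p 1)]
    have h1 : p 1 = 0 := by nlinarith [sq_nonneg (p 0), sq_nonneg (p 1)]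
    ext i; fin_cases i <;> simp [h0, h1]
  refine ⟨fun p => (((p 1 : ℂ) + Complex.I * p 0) ^ 2 / (((p 0) ^ 2 + (p 1) ^ 2 : ℝ) : ℂ)) ^ k *
    Complex.exp ((lam - 1) / 2 * (Real.log ((p 0) ^ 2 + (p 1) ^ 2) : ℝ)), ⟨?_, ?_⟩, ?_⟩
  · have hw : ∀ p : Fin 2 → ℝ, p ≠ 0 → ((p 1 : ℂ) + Complex.I * p 0) ≠ 0 := by
      intro p hp h
      apply hz p hp
      have h1 := congrArg Complex.re h
      have h2 := congrArg Complex.im h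
      simp at h1 h2
      simp [h1, h2]
    intro p hp
    apply ContDiffAt.contDiffWithinAt
    have hr : ContDiffAt ℝ ∞ (fun p : Fin 2 → ℝ => (p 0) ^ 2 + (p 1) ^ 2) p := by fun_prop
    have hr' : ContDiffAt ℝ ∞
        (fun p : Fin 2 → ℝ => (((p 0) ^ 2 + (p 1) ^ 2 : ℝ) : ℂ)) p :=
      Complex.ofRealCLM.contDiff.contDiffAt.comp p hr
    have h0 : ContDiffAt ℝ ∞ (fun p : Fin 2 → ℝ => ((p 0 : ℝ) : ℂ)) p :=
      Complex.ofRealCLM.contDiff.contDiffAt.comp p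
        (by fun_prop : ContDiffAt ℝ ∞ (fun p : Fin 2 → ℝ => p 0) p)
    have h1 : ContDiffAt ℝ ∞ (fun p : Fin 2 → ℝ => ((p 1 : ℝ) : ℂ)) p :=
      Complex.ofRealCLM.contDiff.contDiffAt.comp p
        (by fun_prop : ContDiffAt ℝ ∞ (fun p : Fin 2 → ℝ => p 1) p)
    have hq : ContDiffAt ℝ ∞ (fun p : Fin 2 → ℝ =>
        ((p 1 : ℂ) + Complex.I * p 0) ^ 2 / (((p 0) ^ 2 + (p 1) ^ 2 : ℝ) : ℂ)) p := by
      have := ((h1.add (contDiffAt_const (c := Complex.I) |>.mul h0)).pow 2).mul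
        (hr'.inv (by exact_mod_cast hz p hp))
      simp only [div_eq_mul_inv]
      exact this
    have hl : ContDiffAt ℝ ∞
        (fun p : Fin 2 → ℝ => ((Real.log ((p 0) ^ 2 + (p 1) ^ 2) : ℝ) : ℂ)) p :=
      Complex.ofRealCLM.contDiff.contDiffAt.comp p (hr.log (hz p hp))
    refine ContDiffAt.mul ?_ (contDiffAt_const.mul hl).cexp
    rcases k with k | k
    · simpa using hq.pow k
    · have hne : ((p 1 : ℂ) + Complex.I * p 0) ^ 2 / (((p 0) ^ 2 + (p 1) ^ 2 : ℝ) : ℂ) ≠ 0 :=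
        div_ne_zero (pow_ne_zero _ (hw p hp)) (by exact_mod_cast hz p hp)
      simp only [zpow_negSucc]
      exact (hq.pow (k + 1)).inv (pow_ne_zero _ hne)
  · intro c hc v hv
    have hcc : (c : ℂ) ≠ 0 := by exact_mod_cast hc
    have hac : ((|c| : ℝ) : ℂ) ≠ 0 := by simpa using hc
    have e1 : (c • v) 0 ^ 2 + (c • v) 1 ^ 2 = c ^ 2 * (v 0 ^ 2 + v 1 ^ 2) := by
      simp only [Pi.smul_apply, smul_eq_mul]; ring
    have e2 : (((c • v) 1 : ℝ) : ℂ) + Complex.I * (((c • v) 0 : ℝ) : ℂ) =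
        c * ((v 1 : ℂ) + Complex.I * v 0) := by
      simp only [Pi.smul_apply, smul_eq_mul]; push_cast; ring
    have e3 : Real.log (c ^ 2 * (v 0 ^ 2 + v 1 ^ 2)) =
        2 * Real.log |c| + Real.log (v 0 ^ 2 + v 1 ^ 2) := by
      rw [Real.log_mul (pow_ne_zero 2 hc) (hz v hv), Real.log_pow, Real.log_abs]; norm_num
    simp only [e1, e2, e3]
    have e4 : ((c : ℂ) * ((v 1 : ℂ) + Complex.I * v 0)) ^ 2 /
        ((c ^ 2 * (v 0 ^ 2 + v 1 ^ 2) : ℝ) : ℂ) =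
        ((v 1 : ℂ) + Complex.I * v 0) ^ 2 / ((v 0 ^ 2 + v 1 ^ 2 : ℝ) : ℂ) := by
      rw [mul_pow, Complex.ofReal_mul, Complex.ofReal_pow,
        mul_div_mul_left _ _ (pow_ne_zero 2 hcc)]
    rw [e4, Complex.cpow_def_of_ne_zero hac, ← Complex.ofReal_log (abs_nonneg c)]
    rw [mul_left_comm, ← Complex.exp_add]
    congr 2
    push_cast; ring
  · ext x
    have hpos : (0 : ℝ) < 1 + x ^ 2 := by positivity
    have hcpos : ((1 + x ^ 2 : ℝ) : ℂ) ≠ 0 := by exact_mod_cast hpos.ne'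
    have hs : (Real.sqrt (1 + x ^ 2) : ℂ) ≠ 0 := by
      exact_mod_cast (Real.sqrt_pos.mpr hpos).ne'
    have hexp : Complex.exp (Complex.I * (Real.arctan x : ℂ)) =
        (1 + Complex.I * x) / (Real.sqrt (1 + x ^ 2) : ℂ) := by
      rw [mul_comm, Complex.exp_mul_I, ← Complex.ofReal_cos, ← Complex.ofReal_sin,
        Real.cos_arctan, Real.sin_arctan]
      push_cast
      field_simp
    have hsq : (Real.sqrt (1 + x ^ 2) : ℂ) ^ 2 = ((1 + x ^ 2 : ℝ) : ℂ) := by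
      rw [← Complex.ofReal_pow, Real.sq_sqrt hpos.le]
    have hm : Complex.exp (Complex.I * ((k + k : ℤ) : ℂ) * (Real.arctan x : ℂ)) =
        ((1 + Complex.I * x) ^ 2 / ((1 + x ^ 2 : ℝ) : ℂ)) ^ k := by
      rw [← hsq, ← div_pow, ← hexp, ← Complex.exp_nat_mul, ← Complex.exp_int_mul]
      congr 1
      push_cast; ring
    unfold kType restrictLine
    rw [hm, Complex.cpow_def_of_ne_zero hcpos, ← Complex.ofReal_log hpos.le]
    have hx : x ^ 2 + 1 = 1 + x ^ 2 := add_comm _ _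
    simp only [Matrix.cons_val_zero, Matrix.cons_val_one, one_pow, hx, Complex.ofReal_one]
    congr 2
    ring

end PrincipalSeries

end

/-! In the variable `y = x / a²` the phase of the integrand is `m arctan y - n a² y`. At `a = β` one
has `n a² = m`, and its two critical points merge into a degenerate one at `0`: the transition range
of an Airy function. Put `h = m^(-1/3)`, `y = h z` and `s = (n a² - m) h`. The phase becomes `h⁻³
(arctan (h z) - h z) - s z`, which tends to `-(z³ / 3 + s z)` as `h → 0`, while the amplitude tends
to `1`. The bounds on `ε` say that `0 ≤ s ≤ 3`.

So the Whittaker value has modulus `π⁻¹ a h ‖oscIntegral lam s h‖`, and since `a ≥ β` it suffices to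
bound `oscIntegral` below for `s ∈ [0, 3]` and small `h`. Integration by parts bounds the tails
uniformly (`norm_integral_osc_le`), so `oscIntegral` is continuous up to `h = 0`
(`continuousOn_oscIntegral`). There it is the Airy integral, nonzero for `s ≥ 0`
(`airyIntegral_limit_ne_zero`): a contour shift to the saddle point gives an integral of `exp (-c
x²) cos (x³ / 3)`, positive by `exp_mul_cos_cube_integral_limit_pos`. Compactness of `[0, 3]`
concludes. -/

/-! ### A positive oscillatory integral -/

/-- A primitive, up to a monotone error, of `exp (-c x²) cos (x³ / 3)`. -/
noncomputable def cubicPrimitive (c x : ℝ) : ℝ :=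
  (Real.sin (x ^ 3 / 3) / x ^ 2 + (1 - Real.cos (x ^ 3 / 3)) * (2 / x ^ 5 + 2 * c / x ^ 3)) *
    Real.exp (-c * x ^ 2)

/-- Two integrations by parts. In the second, `1 - cos` is chosen as the primitive: it makes the
error one-signed and cancels the poles at `0`. -/
theorem hasDerivAt_cubicPrimitive (c : ℝ) {x : ℝ} (hx : 0 < x) :
    HasDerivAt (cubicPrimitive c) (Real.exp (-c * x ^ 2) * Real.cos (x ^ 3 / 3) -
      (1 - Real.cos (x ^ 3 / 3)) * ((10 / x ^ 6 + 10 * c / x ^ 4 + 4 * c ^ 2 / x ^ 2) *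
        Real.exp (-c * x ^ 2))) x := by
  have h3 : HasDerivAt (fun x : ℝ => x ^ 3 / 3) (x ^ 2) x := by
    exact ((hasDerivAt_pow 3 x).div_const 3).congr_deriv (by norm_num)
  have hg : HasDerivAt (fun x : ℝ => -c * x ^ 2) (-c * (2 * x)) x := by
    exact ((hasDerivAt_pow 2 x).const_mul (-c)).congr_deriv (by norm_num)
  have hS := h3.sin.div (hasDerivAt_pow 2 x) (by positivity)
  have hk := ((hasDerivAt_const x (2 : ℝ)).div (hasDerivAt_pow 5 x) (by positivity)).add
    ((hasDerivAt_const x (2 * c : ℝ)).div (hasDerivAt_pow 3 x) (by positivity))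
  have hC := (h3.cos.const_sub 1).mul hk
  refine ((hS.add hC).mul hg.exp).congr_deriv ?_
  simp only [Pi.add_apply, Pi.mul_apply, Pi.div_apply]
  field_simp
  push_cast
  ring

theorem tendsto_cubicPrimitive_zero {c : ℝ} (hc : 0 ≤ c) :
    Tendsto (cubicPrimitive c) (𝓝[>] 0) (𝓝 0) := by
  have hb : Tendsto (fun x : ℝ => x / 3 + (x / 9 + c * x ^ 3 / 9)) (𝓝[>] 0) (𝓝 0) := by
    have : Continuous (fun x : ℝ => x / 3 + (x / 9 + c * x ^ 3 / 9)) := by fun_prop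
    simpa using (this.tendsto 0).mono_left nhdsWithin_le_nhds
  refine squeeze_zero_norm' ?_ hb
  filter_upwards [self_mem_nhdsWithin] with x hx
  have hx : 0 < x := hx
  have hS : |Real.sin (x ^ 3 / 3)| ≤ x ^ 3 / 3 := 
    Real.abs_sin_le_abs.trans_eq (abs_of_pos (by positivity))
  have hC0 : 0 ≤ 1 - Real.cos (x ^ 3 / 3) := by linarith [Real.cos_le_one (x ^ 3 / 3)]
  have hC : 1 - Real.cos (x ^ 3 / 3) ≤ (x ^ 3 / 3) ^ 2 / 2 := by
    linarith [Real.one_sub_sq_div_two_le_cos (x := x ^ 3 / 3)]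
  have he : Real.exp (-c * x ^ 2) ≤ 1 := Real.exp_le_one_iff.2 (by nlinarith [sq_nonneg x])
  unfold cubicPrimitive
  rw [norm_mul, Real.norm_eq_abs, Real.norm_eq_abs, Real.abs_exp]
  refine (mul_le_of_le_one_right (abs_nonneg _) he).trans ((abs_add_le _ _).trans ?_)
  gcongr
  · rw [abs_div, abs_of_pos (by positivity : (0 : ℝ) < x ^ 2), div_le_iff₀ (by positivity)]
    linarith
  · rw [abs_of_nonneg (by positivity)]
    refine (mul_le_mul_of_nonneg_right hC (by positivity)).trans (le_of_eq ?_)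
    field_simp
    ring

theorem tendsto_cubicPrimitive_atTop {c : ℝ} (hc : 0 ≤ c) :
    Tendsto (cubicPrimitive c) atTop (𝓝 0) := by
  have hb : Tendsto (fun x : ℝ => (5 + 4 * c) * x⁻¹) atTop (𝓝 0) := by
    simpa using tendsto_inv_atTop_zero.const_mul (5 + 4 * c)
  refine squeeze_zero_norm' ?_ hb
  filter_upwards [eventually_ge_atTop 1] with x hx
  have hx0 : 0 < x := by linarith
  have hinv : ∀ k : ℕ, 1 ≤ k → 1 / x ^ k ≤ x⁻¹ := fun k hk => by
    rw [one_div]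
    exact inv_anti₀ hx0 (le_self_pow₀ hx (by omega))
  have hS : |Real.sin (x ^ 3 / 3)| ≤ 1 := Real.abs_sin_le_one _
  have hC0 : 0 ≤ 1 - Real.cos (x ^ 3 / 3) := by linarith [Real.cos_le_one (x ^ 3 / 3)]
  have hC : 1 - Real.cos (x ^ 3 / 3) ≤ 2 := by linarith [Real.neg_one_le_cos (x ^ 3 / 3)]
  have he : Real.exp (-c * x ^ 2) ≤ 1 := Real.exp_le_one_iff.2 (by nlinarith [sq_nonneg x])
  unfold cubicPrimitive
  rw [norm_mul, Real.norm_eq_abs, Real.norm_eq_abs, Real.abs_exp]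
  refine (mul_le_of_le_one_right (abs_nonneg _) he).trans ((abs_add_le _ _).trans ?_)
  have h1 : |Real.sin (x ^ 3 / 3) / x ^ 2| ≤ x⁻¹ := by
    rw [abs_div, abs_of_pos (by positivity : (0 : ℝ) < x ^ 2)]
    exact (div_le_div_of_nonneg_right hS (by positivity)).trans (hinv 2 (by norm_num))
  have h2 : |(1 - Real.cos (x ^ 3 / 3)) * (2 / x ^ 5 + 2 * c / x ^ 3)| ≤
      2 * (2 * x⁻¹ + 2 * c * x⁻¹) := by
    rw [abs_of_nonneg (by positivity)]
    have h5 : 2 / x ^ 5 ≤ 2 * x⁻¹ := by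
      have := hinv 5 (by norm_num)
      rw [div_eq_mul_one_div]; linarith
    have h6 : 2 * c / x ^ 3 ≤ 2 * c * x⁻¹ := by
      rw [div_eq_mul_one_div]
      exact mul_le_mul_of_nonneg_left (hinv 3 (by norm_num)) (by positivity)
    exact mul_le_mul hC (add_le_add h5 h6) (by positivity) (by norm_num)
  linarith

/-- Limits of `∫₀ᴿ exp (-c x²) cos (x³ / 3) dx` are positive. -/
theorem exp_mul_cos_cube_integral_limit_pos {c L : ℝ} (hc : 0 ≤ c)
    (hL : Tendsto (fun R : ℝ => ∫ x in (0 : ℝ)..R, Real.exp (-c * x ^ 2) * Real.cos (x ^ 3 / 3))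
      atTop (𝓝 L)) : 0 < L := by
  set J : ℝ → ℝ := fun R => ∫ x in (0 : ℝ)..R, Real.exp (-c * x ^ 2) * Real.cos (x ^ 3 / 3)
    with hJ
  have hcont : Continuous fun x : ℝ => Real.exp (-c * x ^ 2) * Real.cos (x ^ 3 / 3) := by fun_prop
  have hJd : ∀ x, HasDerivAt J (Real.exp (-c * x ^ 2) * Real.cos (x ^ 3 / 3)) x := fun x =>
    intervalIntegral.integral_hasDerivAt_right (hcont.intervalIntegrable _ _)
      (hcont.stronglyMeasurableAtFilter _ _) hcont.continuousAt
  -- `Q` is nondecreasing, has limit `0` at `0⁺`, and has limit `L` at infinity because the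
  -- primitive vanishes there.
  set Q : ℝ → ℝ := fun R => J R - cubicPrimitive c R with hQ
  have hQd : ∀ x, 0 < x → HasDerivAt Q ((1 - Real.cos (x ^ 3 / 3)) *
      ((10 / x ^ 6 + 10 * c / x ^ 4 + 4 * c ^ 2 / x ^ 2) * Real.exp (-c * x ^ 2))) x := by
    intro x hx
    exact ((hJd x).sub (hasDerivAt_cubicPrimitive c hx)).congr_deriv (by ring)
  have hQc : ContinuousOn Q (Set.Ioi 0) := fun x hx => (hQd x hx).continuousAt.continuousWithinAt
  have hmono : MonotoneOn Q (Set.Ioi 0) := by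
    refine monotoneOn_of_deriv_nonneg (convex_Ioi 0) hQc ?_ ?_
    · rw [interior_Ioi]
      exact fun x hx => (hQd x hx).differentiableAt.differentiableWithinAt
    · rw [interior_Ioi]
      intro x hx
      have hx : 0 < x := hx
      rw [(hQd x hx).deriv]
      have : 0 ≤ 1 - Real.cos (x ^ 3 / 3) := by linarith [Real.cos_le_one (x ^ 3 / 3)]
      positivity
  -- Strict growth is needed only somewhere; on `(0, 1)` one has `0 < x³ / 3 < π`, so `1 - cos` is
  -- positive.
  have hstrict : StrictMonoOn Q (Set.Ioc 0 1) := by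
    refine strictMonoOn_of_deriv_pos (convex_Ioc 0 1) (hQc.mono fun x hx => hx.1) ?_
    rw [interior_Ioc]
    intro x hx
    have hx0 : 0 < x := hx.1
    rw [(hQd x hx0).deriv]
    have h1 : x ^ 3 / 3 ≤ Real.pi := by
      have : x ^ 3 ≤ 1 := pow_le_one₀ hx0.le hx.2.le
      linarith [Real.pi_gt_three]
    have h2 : Real.cos (x ^ 3 / 3) < Real.cos 0 :=
      Real.strictAntiOn_cos ⟨le_rfl, Real.pi_pos.le⟩ ⟨by positivity, h1⟩ (by positivity)
    rw [Real.cos_zero] at h2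
    have : 0 < 1 - Real.cos (x ^ 3 / 3) := by linarith
    positivity
  have hQ0 : Tendsto Q (𝓝[>] 0) (𝓝 0) := by
    have h1 : Tendsto J (𝓝[>] 0) (𝓝 0) := by
      have := (hJd 0).continuousAt.tendsto
      simp only [hJ, intervalIntegral.integral_same] at this
      exact this.mono_left nhdsWithin_le_nhds
    simpa using h1.sub (tendsto_cubicPrimitive_zero hc)
  have hhalf : 0 ≤ Q (1 / 2) := by
    refine le_of_tendsto hQ0 ?_
    filter_upwards [Ioo_mem_nhdsGT (by norm_num : (0 : ℝ) < 1 / 2)] with x hx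
    exact hmono hx.1 (by norm_num : (0 : ℝ) < 1 / 2) hx.2.le
  have hone : Q (1 / 2) < Q 1 := hstrict (by norm_num) (by norm_num) (by norm_num)
  have hQL : Tendsto Q atTop (𝓝 L) := by
    simpa using hL.sub (tendsto_cubicPrimitive_atTop hc)
  have : Q 1 ≤ L := by
    refine ge_of_tendsto hQL ?_
    filter_upwards [eventually_ge_atTop 1] with x hx
    exact hmono (by norm_num : (0 : ℝ) < 1) (by show (0 : ℝ) < x; linarith) hx
  linarith

/-! ### Nonvanishing of the Airy integral -/

/-- The line `Im z = -η` passes through the saddle point `-iη` of `z³ / 3 + η² z`, so the linear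
term in `x` disappears and a Gaussian factor appears. -/
theorem airyIntegrand_shift (η x : ℝ) :
    Complex.exp (-Complex.I * (((x : ℂ) + (-η : ℝ) * Complex.I) ^ 3 / 3 +
        (η ^ 2 : ℝ) * ((x : ℂ) + (-η : ℝ) * Complex.I))) =
      (Real.exp (-(2 / 3) * η ^ 3) : ℂ) *
        Complex.exp (((-η * x ^ 2 : ℝ) : ℂ) + ((-(x ^ 3 / 3) : ℝ) : ℂ) * Complex.I) := by
  rw [Complex.ofReal_exp, ← Complex.exp_add]
  congr 1
  push_cast
  linear_combination ((x ^ 2 * η : ℂ) - (x * η ^ 2 : ℂ) * Complex.I +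
    (η ^ 3 : ℂ) * (Complex.I ^ 2 / 3 + 2 / 3)) * Complex.I_sq

theorem norm_airyIntegrand (s x y : ℝ) :
    ‖Complex.exp (-Complex.I * (((x : ℂ) + y * Complex.I) ^ 3 / 3 +
        s * ((x : ℂ) + y * Complex.I)))‖ = Real.exp (x ^ 2 * y - y ^ 3 / 3 + s * y) := by
  rw [Complex.norm_exp]
  congr 1
  have : -Complex.I * (((x : ℂ) + y * Complex.I) ^ 3 / 3 + s * ((x : ℂ) + y * Complex.I)) =
      ((x ^ 2 * y - y ^ 3 / 3 + s * y : ℝ) : ℂ) +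
        ((-(x ^ 3 / 3) + x * y ^ 2 - s * x : ℝ) : ℂ) * Complex.I := by
    push_cast
    linear_combination (-(x ^ 2 * y : ℂ) - (x * y ^ 2 : ℂ) * Complex.I - s * y
      + (y ^ 3 / 3 : ℂ) - (y ^ 3 / 3 : ℂ) * Complex.I ^ 2) * Complex.I_sq
  rw [this]
  rw [Complex.add_re, Complex.re_ofReal_mul, Complex.ofReal_re, Complex.I_re, mul_zero, add_zero]

/-- The integral over a vertical segment of the Airy integrand is `O(R⁻²)`. -/
theorem norm_integral_airyIntegrand_vertical_le {s η x : ℝ} (hs : 0 ≤ s) (hη : 0 ≤ η)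
    (hx : x ≠ 0) :
    ‖∫ y in (-η)..0, Complex.exp (-Complex.I * (((x : ℂ) + y * Complex.I) ^ 3 / 3 +
        s * ((x : ℂ) + y * Complex.I)))‖ ≤ Real.exp (η ^ 3 / 3) * (x ^ 2)⁻¹ := by
  have hx2 : 0 < x ^ 2 := by positivity
  have h1 : ‖∫ y in (-η)..0, Complex.exp (-Complex.I * (((x : ℂ) + y * Complex.I) ^ 3 / 3 +
        s * ((x : ℂ) + y * Complex.I)))‖ ≤
      ∫ y in (-η)..0, Real.exp (η ^ 3 / 3) * Real.exp (x ^ 2 * y) := by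
    refine intervalIntegral.norm_integral_le_of_norm_le (by linarith) ?_
      (Continuous.intervalIntegrable (by fun_prop) _ _)
    refine MeasureTheory.ae_of_all _ fun y hy => ?_
    rw [norm_airyIntegrand, ← Real.exp_add]
    -- On `-η ≤ y ≤ 0` only `exp (x² y)` depends on `x`, and its integral is at most `x⁻²`.
    refine Real.exp_le_exp.2 ?_
    have hy3 : (-y) ^ 3 ≤ η ^ 3 := pow_le_pow_left₀ (by linarith [hy.2]) (by linarith [hy.1]) 3
    have : s * y ≤ 0 := mul_nonpos_of_nonneg_of_nonpos hs hy.2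
    have h3 : (-y) ^ 3 = -y ^ 3 := by ring
    linarith
  refine h1.trans ?_
  rw [intervalIntegral.integral_const_mul,
    intervalIntegral.integral_comp_mul_left (fun u => Real.exp u) hx2.ne', integral_exp]
  refine mul_le_mul_of_nonneg_left ?_ (Real.exp_pos _).le
  rw [smul_eq_mul, mul_zero, Real.exp_zero]
  exact mul_le_of_le_one_right (inv_nonneg.2 hx2.le) (by linarith [Real.exp_pos (x ^ 2 * -η)])

/-- The Airy integral `∫ exp (-i (x³ / 3 + s x)) dx` does not vanish for `s ≥ 0`. -/
theorem airyIntegral_limit_ne_zero {s : ℝ} (hs : 0 ≤ s) {L : ℂ}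
    (hL : Tendsto (fun R : ℝ => ∫ x in (-R)..R,
      Complex.exp (-Complex.I * ((x : ℂ) ^ 3 / 3 + s * x))) atTop (𝓝 L)) : L ≠ 0 := by
  set η := Real.sqrt s with hη
  have hη0 : 0 ≤ η := Real.sqrt_nonneg s
  have hηs : s = η ^ 2 := (Real.sq_sqrt hs).symm
  set f : ℂ → ℂ := fun z => Complex.exp (-Complex.I * (z ^ 3 / 3 + s * z)) with hf
  have hfd : Differentiable ℂ f := by fun_prop
  have hv : ∀ σ : ℝ, σ ^ 2 = 1 → Tendsto (fun R : ℝ =>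
      ∫ y in (-η)..0, f ((σ * R : ℝ) + y * Complex.I)) atTop (𝓝 0) := by
    intro σ hσ
    have hlim : Tendsto (fun R : ℝ => Real.exp (η ^ 3 / 3) * (R ^ 2)⁻¹) atTop (𝓝 0) := by
      simpa using (tendsto_inv_atTop_zero.comp
        (tendsto_pow_atTop (α := ℝ) two_ne_zero)).const_mul (Real.exp (η ^ 3 / 3))
    refine squeeze_zero_norm' ?_ hlim
    filter_upwards [eventually_gt_atTop 0] with R hR
    have hne : σ * R ≠ 0 := mul_ne_zero (fun h => by simp [h] at hσ) hR.ne'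
    have := norm_integral_airyIntegrand_vertical_le hs hη0 hne
    rwa [mul_pow, hσ, one_mul] at this
  have hshift : Tendsto (fun R : ℝ => ∫ x in (-R)..R, f ((x : ℂ) + (-η : ℝ) * Complex.I)) atTop
      (𝓝 L) := by
    have hL' : Tendsto (fun R : ℝ => ∫ x in (-R)..R, f x) atTop (𝓝 L) := hL
    have h := (hL'.sub ((hv 1 (by norm_num)).const_smul Complex.I)).add
      ((hv (-1) (by norm_num)).const_smul Complex.I)
    rw [smul_zero, sub_zero, add_zero] at h
    refine h.congr fun R => ?_
    -- Cauchy's theorem on `[-R, R] × [-η, 0]`; the vertical sides vanish in the limit by `hv` with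
    -- `σ = ±1`.
    have hrect := Complex.integral_boundary_rect_eq_zero_of_differentiableOn f
      (⟨-R, -η⟩ : ℂ) (⟨R, 0⟩ : ℂ) hfd.differentiableOn
    simp only [Complex.ofReal_zero, zero_mul, add_zero] at hrect
    rw [one_mul, neg_one_mul]
    linear_combination -hrect
  have hre : ∀ R : ℝ, (∫ x in (-R)..R, f ((x : ℂ) + (-η : ℝ) * Complex.I)).re =
      2 * Real.exp (-(2 / 3) * η ^ 3) *
        ∫ x in (0 : ℝ)..R, Real.exp (-η * x ^ 2) * Real.cos (x ^ 3 / 3) := by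
    intro R
    have hfc : Continuous fun x : ℝ => f ((x : ℂ) + (-η : ℝ) * Complex.I) :=
      hfd.continuous.comp (by fun_prop)
    have hgc : Continuous fun x : ℝ => Real.exp (-η * x ^ 2) * Real.cos (x ^ 3 / 3) := by fun_prop
    have h1 := Complex.reCLM.intervalIntegral_comp_comm
      (hfc.intervalIntegrable (μ := MeasureTheory.volume) (-R) R)
    simp only [Complex.reCLM_apply] at h1
    rw [← h1]
    have h2 : ∀ x : ℝ, (f ((x : ℂ) + (-η : ℝ) * Complex.I)).re =
        Real.exp (-(2 / 3) * η ^ 3) * (Real.exp (-η * x ^ 2) * Real.cos (x ^ 3 / 3)) := by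
      intro x
      simp only [hf]
      rw [hηs, airyIntegrand_shift, Complex.re_ofReal_mul, Complex.exp_re]
      have hr : (((-η * x ^ 2 : ℝ) : ℂ) + ((-(x ^ 3 / 3) : ℝ) : ℂ) * Complex.I).re =
          -η * x ^ 2 := by
        rw [Complex.add_re, Complex.re_ofReal_mul, Complex.ofReal_re, Complex.I_re, mul_zero,
          add_zero]
      have hi : (((-η * x ^ 2 : ℝ) : ℂ) + ((-(x ^ 3 / 3) : ℝ) : ℂ) * Complex.I).im =
          -(x ^ 3 / 3) := by
        rw [Complex.add_im, Complex.im_ofReal_mul, Complex.ofReal_im, Complex.I_im, mul_one,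
          zero_add]
      rw [hr, hi, Real.cos_neg]
    simp only [h2]
    rw [intervalIntegral.integral_const_mul, ← intervalIntegral.integral_add_adjacent_intervals
      (hgc.intervalIntegrable (-R) 0) (hgc.intervalIntegrable 0 R)]
    have h3 := intervalIntegral.integral_comp_neg (a := 0) (b := R)
      (fun x : ℝ => Real.exp (-η * x ^ 2) * Real.cos (x ^ 3 / 3))
    rw [neg_zero] at h3
    rw [← h3]
    have h4 : ∀ x : ℝ, Real.cos ((-x) ^ 3 / 3) = Real.cos (x ^ 3 / 3) := fun x => by
      rw [← Real.cos_neg]; ring_nf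
    simp only [h4, neg_sq]
    ring
  have hpos := Real.exp_pos (-(2 / 3) * η ^ 3)
  have hLre := (Complex.continuous_re.tendsto L).comp hshift
  simp only [Function.comp_def, hre] at hLre
  have hJ := hLre.const_mul (2 * Real.exp (-(2 / 3) * η ^ 3))⁻¹
  simp only [inv_mul_cancel_left₀ (mul_pos two_pos hpos).ne'] at hJ
  have h0 := exp_mul_cos_cube_integral_limit_pos hη0 hJ
  intro h
  simp [h] at h0

/-! ### A family of oscillatory integrals degenerating to the Airy integral -/

/-- The phase `-(s z + ∫₀ᶻ w² / (1 + h² w²) dw)`. For `h = 0` it is `-(s z + z³ / 3)`, otherwise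
`h⁻³ (arctan (h z) - h z) - s z`. -/
noncomputable def phase (s h z : ℝ) : ℝ :=
  -(s * z + ∫ w in (0 : ℝ)..z, w ^ 2 / (1 + h ^ 2 * w ^ 2))

/-- The amplitude `(1 + h² z²) ^ ((lam - 1) / 2)`. -/
noncomputable def amp (lam : ℂ) (h z : ℝ) : ℂ := ((1 + h ^ 2 * z ^ 2 : ℝ) : ℂ) ^ ((lam - 1) / 2)

/-- The oscillating integrand with phase `phase s h` and amplitude `amp lam h`. -/
noncomputable def osc (lam : ℂ) (s h z : ℝ) : ℂ :=
  Complex.exp (Complex.I * phase s h z) * amp lam h z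

theorem one_add_sq_mul_sq_pos (h z : ℝ) : 0 < 1 + h ^ 2 * z ^ 2 := by positivity

/-- The integral form of the phase has no singularity at `h = 0`, so continuity includes the Airy
case. -/
theorem continuous_phase : Continuous fun p : (ℝ × ℝ) × ℝ => phase p.1.1 p.1.2 p.2 := by
  have h1 : Continuous fun q : (ℝ × ℝ) × ℝ => q.2 ^ 2 / (1 + q.1.1 ^ 2 * q.2 ^ 2) :=
    Continuous.div (by fun_prop) (by fun_prop) fun q => (one_add_sq_mul_sq_pos _ _).ne'
  have h2 : Continuous fun q : ℝ × ℝ => ∫ w in (0 : ℝ)..q.2, w ^ 2 / (1 + q.1 ^ 2 * w ^ 2) :=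
    intervalIntegral.continuous_parametric_intervalIntegral_of_continuous
      (f := fun (q : ℝ × ℝ) (w : ℝ) => w ^ 2 / (1 + q.1 ^ 2 * w ^ 2)) h1 continuous_snd
  have h3 : Continuous fun p : (ℝ × ℝ) × ℝ =>
      ∫ w in (0 : ℝ)..p.2, w ^ 2 / (1 + p.1.2 ^ 2 * w ^ 2) :=
    h2.comp ((continuous_snd.comp continuous_fst).prodMk continuous_snd)
  unfold phase
  fun_prop

theorem continuous_amp (lam : ℂ) : Continuous fun p : ℝ × ℝ => amp lam p.1 p.2 := by
  unfold amp
  refine Continuous.cpow (by fun_prop) continuous_const fun p => ?_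
  exact Complex.ofReal_mem_slitPlane.2 (one_add_sq_mul_sq_pos _ _)

theorem continuous_osc (lam : ℂ) :
    Continuous fun p : (ℝ × ℝ) × ℝ => osc lam p.1.1 p.1.2 p.2 := by
  have h1 := continuous_phase
  have h2 : Continuous fun p : (ℝ × ℝ) × ℝ => amp lam p.1.2 p.2 :=
    (continuous_amp lam).comp ((continuous_snd.comp continuous_fst).prodMk continuous_snd)
  unfold osc
  fun_prop

theorem continuous_osc_right (lam : ℂ) (s h : ℝ) : Continuous (osc lam s h) :=
  (continuous_osc lam).comp (Continuous.prodMk_right (s, h))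

theorem hasDerivAt_phase (s h z : ℝ) :
    HasDerivAt (phase s h) (-(s + z ^ 2 / (1 + h ^ 2 * z ^ 2))) z := by
  have hc : Continuous fun w : ℝ => w ^ 2 / (1 + h ^ 2 * w ^ 2) :=
    Continuous.div (by fun_prop) (by fun_prop) fun q => (one_add_sq_mul_sq_pos _ _).ne'
  have h1 := intervalIntegral.integral_hasDerivAt_right (hc.intervalIntegrable 0 z)
    (hc.stronglyMeasurableAtFilter _ _) hc.continuousAt
  exact ((((hasDerivAt_id z).const_mul s).add h1).neg).congr_deriv (by simp)

theorem hasDerivAt_amp (lam : ℂ) (h z : ℝ) :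
    HasDerivAt (amp lam h)
      ((lam - 1) * ((h ^ 2 * z / (1 + h ^ 2 * z ^ 2) : ℝ) : ℂ) * amp lam h z) z := by
  have hu : HasDerivAt (fun z : ℝ => ((1 + h ^ 2 * z ^ 2 : ℝ) : ℂ)) ((h ^ 2 * (2 * z) : ℝ) : ℂ) z :=
    ((((hasDerivAt_pow 2 z).const_mul (h ^ 2)).const_add 1).congr_deriv (by norm_num)).ofReal_comp
  have hne : ((1 + h ^ 2 * z ^ 2 : ℝ) : ℂ) ≠ 0 := by
    exact_mod_cast (one_add_sq_mul_sq_pos h z).ne'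
  have hp := (Complex.hasStrictDerivAt_cpow_const (c := (lam - 1) / 2)
    (Complex.ofReal_mem_slitPlane.2 (one_add_sq_mul_sq_pos h z))).hasDerivAt
  refine (hp.scomp z hu).congr_deriv ?_
  rw [Complex.cpow_sub _ _ hne, Complex.cpow_one, amp, smul_eq_mul]
  push_cast at hne ⊢
  field_simp

theorem norm_amp {lam : ℂ} (hlam : lam.re = 0) (h z : ℝ) :
    ‖amp lam h z‖ = (Real.sqrt (1 + h ^ 2 * z ^ 2))⁻¹ := by
  have hu := one_add_sq_mul_sq_pos h z
  unfold amp
  rw [Complex.norm_cpow_eq_rpow_re_of_pos hu, Real.sqrt_eq_rpow, ← Real.rpow_neg hu.le]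
  congr 1
  simp [hlam]
  norm_num

/-! ### Integration by parts and uniform tails -/

/-- The first term of the integration by parts of `osc`. -/
noncomputable def oscPrimitive (lam : ℂ) (s h z : ℝ) : ℂ :=
  Complex.I * ((1 + h ^ 2 * z ^ 2) / (z ^ 2 + s * (1 + h ^ 2 * z ^ 2)) : ℝ) * osc lam s h z

/-- With `u = 1 + h² z²` and `v = z² + s u`, the phase has derivative `-v / u`, so the primitive is
`osc` divided by `i` times it. The error comes from `u' v - u v' = -2 z` and from the derivative of
the amplitude. -/
theorem hasDerivAt_oscPrimitive (lam : ℂ) {s : ℝ} (hs : 0 ≤ s) (h : ℝ) {z : ℝ} (hz : z ≠ 0) :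
    HasDerivAt (oscPrimitive lam s h) (osc lam s h z + Complex.I * osc lam s h z *
      ((-(2 * z) / (z ^ 2 + s * (1 + h ^ 2 * z ^ 2)) ^ 2 : ℝ) +
        (lam - 1) * (h ^ 2 * z / (z ^ 2 + s * (1 + h ^ 2 * z ^ 2)) : ℝ))) z := by
  have hu := one_add_sq_mul_sq_pos h z
  have hv : 0 < z ^ 2 + s * (1 + h ^ 2 * z ^ 2) := by positivity
  have hud : HasDerivAt (fun z : ℝ => 1 + h ^ 2 * z ^ 2) (h ^ 2 * (2 * z)) z :=
    (((hasDerivAt_pow 2 z).const_mul (h ^ 2)).const_add 1).congr_deriv (by norm_num)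
  have hvd := (hasDerivAt_pow 2 z).add (hud.const_mul s)
  have hq : HasDerivAt (fun z : ℝ => (1 + h ^ 2 * z ^ 2) / (z ^ 2 + s * (1 + h ^ 2 * z ^ 2)))
      (-(2 * z) / (z ^ 2 + s * (1 + h ^ 2 * z ^ 2)) ^ 2) z := by
    refine (hud.div hvd hv.ne').congr_deriv ?_
    simp only [Pi.add_apply]
    congr 1
    push_cast
    ring
  have hexp := ((hasDerivAt_phase s h z).ofReal_comp.const_mul Complex.I).cexp
  have hosc := hexp.mul (hasDerivAt_amp lam h z)
  refine ((hq.ofReal_comp.const_mul Complex.I).mul hosc).congr_deriv ?_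
  have hu' : (1 + h ^ 2 * z ^ 2 : ℂ) ≠ 0 := by exact_mod_cast hu.ne'
  have hv' : (z ^ 2 + s * (1 + h ^ 2 * z ^ 2) : ℂ) ≠ 0 := by exact_mod_cast hv.ne'
  simp only [Pi.mul_apply, osc]
  push_cast
  generalize Complex.exp (Complex.I * phase s h z) = e
  generalize amp lam h z = b
  have key : (1 + h ^ 2 * z ^ 2 : ℂ) / (z ^ 2 + s * (1 + h ^ 2 * z ^ 2)) *
      (s + z ^ 2 / (1 + h ^ 2 * z ^ 2)) = 1 := by
    rw [div_mul_eq_mul_div, mul_add, mul_div_cancel₀ _ hu', div_eq_one_iff_eq hv']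
    ring
  have key2 : (1 + h ^ 2 * z ^ 2 : ℂ) / (z ^ 2 + s * (1 + h ^ 2 * z ^ 2)) *
      (h ^ 2 * z / (1 + h ^ 2 * z ^ 2)) = h ^ 2 * z / (z ^ 2 + s * (1 + h ^ 2 * z ^ 2)) := by
    field_simp
  linear_combination (e * b) * key + Complex.I * (lam - 1) * e * b * key2 -
    (1 + h ^ 2 * z ^ 2 : ℂ) / (z ^ 2 + s * (1 + h ^ 2 * z ^ 2)) *
      (s + z ^ 2 / (1 + h ^ 2 * z ^ 2)) * e * b * Complex.I_sq

theorem norm_osc {lam : ℂ} (hlam : lam.re = 0) (s h z : ℝ) :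
    ‖osc lam s h z‖ = (Real.sqrt (1 + h ^ 2 * z ^ 2))⁻¹ := by
  rw [osc, norm_mul, norm_amp hlam, mul_comm Complex.I, Complex.norm_exp_ofReal_mul_I, one_mul]

theorem norm_oscPrimitive_le {lam : ℂ} (hlam : lam.re = 0) {s h z : ℝ} (hs : 0 ≤ s)
    (h0 : 0 ≤ h) (h1 : h ≤ 1) (hz : 1 ≤ |z|) : ‖oscPrimitive lam s h z‖ ≤ 2 / |z| := by
  have hu := one_add_sq_mul_sq_pos h z
  have hz0 : 0 < |z| := by linarith
  have hz2 : 0 < z ^ 2 := by rw [← sq_abs]; positivity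
  have hr : Real.sqrt (1 + h ^ 2 * z ^ 2) ≤ 1 + |z| := by
    refine Real.sqrt_le_iff.2 ⟨by positivity, ?_⟩
    have : h ^ 2 * z ^ 2 ≤ 1 * z ^ 2 := by gcongr; exact pow_le_one₀ h0 h1
    nlinarith [sq_abs z]
  rw [oscPrimitive, norm_mul, norm_mul, norm_osc hlam, Complex.norm_I, one_mul, Complex.norm_real,
    Real.norm_eq_abs, abs_of_nonneg (by positivity)]
  calc _ = Real.sqrt (1 + h ^ 2 * z ^ 2) / (z ^ 2 + s * (1 + h ^ 2 * z ^ 2)) := by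
        have := Real.sqrt_pos.2 hu
        rw [div_mul_eq_mul_div, ← div_eq_mul_inv, Real.div_sqrt]
    _ ≤ (1 + |z|) / z ^ 2 := by
        gcongr
        nlinarith [mul_nonneg hs hu.le]
    _ ≤ 2 / |z| := by
        rw [div_le_div_iff₀ hz2 hz0, ← sq_abs]
        nlinarith

theorem norm_oscPrimitive_error_le {lam : ℂ} (hlam : lam.re = 0) {s h z : ℝ} (hs : 0 ≤ s)
    (h0 : 0 ≤ h) (h1 : h ≤ 1) (hz : 1 ≤ |z|) :
    ‖Complex.I * osc lam s h z *
      ((-(2 * z) / (z ^ 2 + s * (1 + h ^ 2 * z ^ 2)) ^ 2 : ℝ) +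
        (lam - 1) * (h ^ 2 * z / (z ^ 2 + s * (1 + h ^ 2 * z ^ 2)) : ℝ))‖ ≤
      (2 + ‖lam - 1‖) / z ^ 2 := by
  have hu := one_add_sq_mul_sq_pos h z
  have hz0 : 0 < |z| := by linarith
  have hz2 : 0 < z ^ 2 := by rw [← sq_abs]; positivity
  have hv : z ^ 2 ≤ z ^ 2 + s * (1 + h ^ 2 * z ^ 2) := by nlinarith [mul_nonneg hs hu.le]
  have hr1 : 1 ≤ Real.sqrt (1 + h ^ 2 * z ^ 2) := Real.one_le_sqrt.2 (by nlinarith [sq_nonneg (h * z)])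
  have hrh : h * |z| ≤ Real.sqrt (1 + h ^ 2 * z ^ 2) := by
    refine Real.le_sqrt_of_sq_le ?_
    rw [mul_pow, sq_abs]; linarith
  have hr0 : 0 < Real.sqrt (1 + h ^ 2 * z ^ 2) := by linarith
  rw [norm_mul, norm_mul, norm_osc hlam, Complex.norm_I, one_mul]
  refine (mul_le_mul_of_nonneg_left (norm_add_le _ _) (inv_nonneg.2 hr0.le)).trans ?_
  rw [norm_mul, Complex.norm_real, Complex.norm_real, Real.norm_eq_abs, Real.norm_eq_abs, abs_div,
    abs_div, abs_neg, abs_mul, abs_mul, abs_of_nonneg (by positivity : 0 ≤ h ^ 2), abs_two,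
    abs_of_pos (by positivity : 0 < z ^ 2 + s * (1 + h ^ 2 * z ^ 2)), abs_of_pos (by positivity :
      0 < (z ^ 2 + s * (1 + h ^ 2 * z ^ 2)) ^ 2), mul_add, add_div]
  refine add_le_add ?_ ?_
  · refine (mul_le_of_le_one_left (by positivity) (inv_le_one_of_one_le₀ hr1)).trans ?_
    calc 2 * |z| / (z ^ 2 + s * (1 + h ^ 2 * z ^ 2)) ^ 2 ≤ 2 * |z| / (z ^ 2) ^ 2 := by gcongr
      _ ≤ 2 / z ^ 2 := by
        rw [div_le_div_iff₀ (by positivity) hz2]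
        have : |z| ≤ z ^ 2 := by rw [← sq_abs]; nlinarith
        nlinarith
  -- Without the amplitude this term is only `O(1 / |z|)`; `h |z| ≤ √(1 + h² z²)` gains the missing
  -- power uniformly in `h`.
  · calc (Real.sqrt (1 + h ^ 2 * z ^ 2))⁻¹ * (‖lam - 1‖ * (h ^ 2 * |z| /
          (z ^ 2 + s * (1 + h ^ 2 * z ^ 2))))
        = h * ((h * |z|) / Real.sqrt (1 + h ^ 2 * z ^ 2)) * (‖lam - 1‖ /
          (z ^ 2 + s * (1 + h ^ 2 * z ^ 2))) := by
          field_simp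
      _ ≤ 1 * 1 * (‖lam - 1‖ / z ^ 2) := by
          gcongr
          exact (div_le_one hr0).2 hrh
      _ = ‖lam - 1‖ / z ^ 2 := by ring

/-- Uniform decay of the tails of the integral of `osc`. -/
theorem norm_integral_osc_le {lam : ℂ} (hlam : lam.re = 0) {s h : ℝ} (hs : 0 ≤ s)
    (h0 : 0 ≤ h) (h1 : h ≤ 1) {R p q : ℝ} (hR : 1 ≤ R)
    (hpq : R ≤ p ∧ R ≤ q ∨ p ≤ -R ∧ q ≤ -R) :
    ‖∫ z in p..q, osc lam s h z‖ ≤ (6 + ‖lam - 1‖) / R := by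
  wlog hle : p ≤ q generalizing p q
  · rw [intervalIntegral.integral_symm, norm_neg]
    exact this (by tauto) (le_of_not_ge hle)
  have hR0 : 0 < R := by linarith
  have hfar : ∀ z ∈ Set.Icc p q, R ≤ |z| := fun z hz => by
    rcases hpq with hpq | hpq
    · exact (hpq.1.trans hz.1).trans (le_abs_self z)
    · exact (by linarith [hz.2, hpq.2] : R ≤ -z).trans (neg_le_abs z)
  have hne : ∀ z ∈ Set.Icc p q, z ≠ 0 := fun z hz h => by
    have := hfar z hz
    rw [h, abs_zero] at this
    linarith
  have hc := continuous_osc_right lam s h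
  -- The remainder of the integration by parts, bounded by comparing its derivative with that of `(2
  -- + ‖lam - 1‖) (p⁻¹ - z⁻¹)`.
  set Φ : ℝ → ℂ := fun z => (∫ w in p..z, osc lam s h w) -
    (oscPrimitive lam s h z - oscPrimitive lam s h p) with hΦ
  have hd : ∀ z ∈ Set.Icc p q, HasDerivAt Φ (-(Complex.I * osc lam s h z *
      ((-(2 * z) / (z ^ 2 + s * (1 + h ^ 2 * z ^ 2)) ^ 2 : ℝ) +
        (lam - 1) * (h ^ 2 * z / (z ^ 2 + s * (1 + h ^ 2 * z ^ 2)) : ℝ)))) z := by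
    intro z hz
    have hJ := intervalIntegral.integral_hasDerivAt_right (hc.intervalIntegrable p z)
      (hc.stronglyMeasurableAtFilter _ _) hc.continuousAt
    exact (hJ.sub ((hasDerivAt_oscPrimitive lam hs h (hne z hz)).sub_const _)).congr_deriv (by ring)
  have hB : ∀ z ∈ Set.Icc p q, HasDerivAt (fun z : ℝ => (2 + ‖lam - 1‖) * (p⁻¹ - z⁻¹))
      ((2 + ‖lam - 1‖) / z ^ 2) z := fun z hz =>
    (((hasDerivAt_inv (hne z hz)).const_sub p⁻¹).const_mul (2 + ‖lam - 1‖)).congr_deriv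
      (by rw [neg_neg, div_eq_mul_inv])
  have hmain := image_norm_le_of_norm_deriv_right_le_deriv_boundary'
    (fun z hz => (hd z hz).continuousAt.continuousWithinAt)
    (fun z hz => (hd z (Set.Ico_subset_Icc_self hz)).hasDerivWithinAt)
    (by simp [hΦ])
    (fun z hz => (hB z hz).continuousAt.continuousWithinAt)
    (fun z hz => (hB z (Set.Ico_subset_Icc_self hz)).hasDerivWithinAt)
    (fun z hz => by
      rw [norm_neg]
      exact norm_oscPrimitive_error_le hlam hs h0 h1
        (hR.trans (hfar z (Set.Ico_subset_Icc_self hz)))) (Set.right_mem_Icc.2 hle)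
  have hinv : p⁻¹ - q⁻¹ ≤ R⁻¹ := by
    rcases hpq with hpq | hpq
    · have h2 : p⁻¹ ≤ R⁻¹ := inv_anti₀ hR0 hpq.1
      have h3 : 0 ≤ q⁻¹ := inv_nonneg.2 (by linarith)
      linarith
    · have h2 : (-q)⁻¹ ≤ R⁻¹ := inv_anti₀ hR0 (by linarith)
      have h3 : p⁻¹ ≤ 0 := inv_nonpos.2 (by linarith)
      rw [inv_neg] at h2
      linarith
  have hE : ∀ z ∈ Set.Icc p q, ‖oscPrimitive lam s h z‖ ≤ 2 / R := fun z hz =>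
    (norm_oscPrimitive_le hlam hs h0 h1 (hR.trans (hfar z hz))).trans
      (div_le_div_of_nonneg_left zero_le_two hR0 (hfar z hz))
  have hEp := hE p (Set.left_mem_Icc.2 hle)
  have hEq := hE q (Set.right_mem_Icc.2 hle)
  have hsplit : ∫ z in p..q, osc lam s h z =
      Φ q + (oscPrimitive lam s h q - oscPrimitive lam s h p) := by simp [hΦ]
  rw [hsplit]
  have hK : (2 + ‖lam - 1‖) * (p⁻¹ - q⁻¹) ≤ (2 + ‖lam - 1‖) * R⁻¹ :=
    mul_le_mul_of_nonneg_left hinv (by positivity)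
  -- The `6` is `2` from the remainder plus `2` from each boundary term.
  calc _ ≤ ‖Φ q‖ + (‖oscPrimitive lam s h q‖ + ‖oscPrimitive lam s h p‖) :=
        (norm_add_le _ _).trans (add_le_add_right (norm_sub_le _ _) _)
    _ ≤ (2 + ‖lam - 1‖) * R⁻¹ + (2 / R + 2 / R) := by linarith
    _ = (6 + ‖lam - 1‖) / R := by ring

/-! ### The improper integral and its dependence on the parameters -/

theorem tendsto_neg_id_atBot_prod_atTop :
    Tendsto (fun R : ℝ => (-R, R)) atTop (atBot ×ˢ atTop) :=
  tendsto_neg_atTop_atBot.prodMk tendsto_id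

/-- The improper integral of `osc` over the line. -/
noncomputable def oscIntegral (lam : ℂ) (s h : ℝ) : ℂ :=
  limUnder (atBot ×ˢ atTop) fun p : ℝ × ℝ => ∫ z in p.1..p.2, osc lam s h z

theorem norm_integral_osc_sub_le {lam : ℂ} (hlam : lam.re = 0) {s h : ℝ} (hs : 0 ≤ s)
    (h0 : 0 ≤ h) (h1 : h ≤ 1) {R : ℝ} (hR : 1 ≤ R) {p q : ℝ × ℝ} (hp1 : p.1 ≤ -R) (hp2 : R ≤ p.2)
    (hq1 : q.1 ≤ -R) (hq2 : R ≤ q.2) :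
    ‖(∫ z in p.1..p.2, osc lam s h z) - ∫ z in q.1..q.2, osc lam s h z‖ ≤
      2 * (6 + ‖lam - 1‖) / R := by
  have hc := continuous_osc_right lam s h
  have hi : ∀ a b, IntervalIntegrable (osc lam s h) MeasureTheory.volume a b :=
    fun a b => hc.intervalIntegrable a b
  rw [intervalIntegral.integral_interval_sub_interval_comm (hi _ _) (hi _ _) (hi _ _)]
  refine (norm_sub_le _ _).trans ?_
  have e1 := norm_integral_osc_le hlam hs h0 h1 hR (p := p.1) (q := q.1) (Or.inr ⟨hp1, hq1⟩)
  have e2 := norm_integral_osc_le hlam hs h0 h1 hR (p := p.2) (q := q.2) (Or.inl ⟨hp2, hq2⟩)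
  rw [mul_div_assoc]
  linarith

theorem tendsto_oscIntegral {lam : ℂ} (hlam : lam.re = 0) {s h : ℝ} (hs : 0 ≤ s)
    (h0 : 0 ≤ h) (h1 : h ≤ 1) :
    Tendsto (fun p : ℝ × ℝ => ∫ z in p.1..p.2, osc lam s h z) (atBot ×ˢ atTop)
      (𝓝 (oscIntegral lam s h)) := by
  refine tendsto_nhds_limUnder (cauchy_map_iff_exists_tendsto.1 (Metric.cauchy_iff.2
    ⟨inferInstance, fun e he => ?_⟩))
  set R := max 1 (2 * (6 + ‖lam - 1‖) / e + 1) with hR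
  have hR1 : 1 ≤ R := le_max_left _ _
  have hR2 : 2 * (6 + ‖lam - 1‖) / e < R := lt_of_lt_of_le (lt_add_one _) (le_max_right _ _)
  refine ⟨_, image_mem_map (prod_mem_prod (Iic_mem_atBot (-R)) (Ici_mem_atTop R)), ?_⟩
  rintro _ ⟨p, hp, rfl⟩ _ ⟨q, hq, rfl⟩
  rw [dist_eq_norm]
  refine (norm_integral_osc_sub_le hlam hs h0 h1 hR1 hp.1 hp.2 hq.1 hq.2).trans_lt ?_
  rw [div_lt_iff₀ (by linarith)]
  rw [div_lt_iff₀ he] at hR2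
  linarith

theorem norm_oscIntegral_sub_le {lam : ℂ} (hlam : lam.re = 0) {s h : ℝ} (hs : 0 ≤ s)
    (h0 : 0 ≤ h) (h1 : h ≤ 1) {R : ℝ} (hR : 1 ≤ R) :
    ‖oscIntegral lam s h - ∫ z in (-R)..R, osc lam s h z‖ ≤ 2 * (6 + ‖lam - 1‖) / R := by
  have ht := ((tendsto_oscIntegral hlam hs h0 h1).comp tendsto_neg_id_atBot_prod_atTop).sub_const
    (∫ z in (-R)..R, osc lam s h z)
  refine le_of_tendsto ht.norm ?_
  filter_upwards [eventually_ge_atTop R] with S hS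
  exact norm_integral_osc_sub_le hlam hs h0 h1 hR (p := (-S, S)) (q := (-R, R))
    (neg_le_neg hS) hS le_rfl le_rfl

/-- The truncated integrals are continuous in `(s, h)` and converge uniformly, since the tail bound
does not involve `s` or `h`. -/
theorem continuousOn_oscIntegral {lam : ℂ} (hlam : lam.re = 0) :
    ContinuousOn (fun p : ℝ × ℝ => oscIntegral lam p.1 p.2) (Set.Ici 0 ×ˢ Set.Icc 0 1) := by
  have hu : TendstoUniformlyOn (fun (R : ℝ) (p : ℝ × ℝ) => ∫ z in (-R)..R, osc lam p.1 p.2 z)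
      (fun p : ℝ × ℝ => oscIntegral lam p.1 p.2) atTop (Set.Ici 0 ×ˢ Set.Icc 0 1) := by
    rw [Metric.tendstoUniformlyOn_iff]
    intro e he
    filter_upwards [eventually_ge_atTop 1, eventually_gt_atTop (2 * (6 + ‖lam - 1‖) / e)]
      with R hR1 hR2 p hp
    rw [dist_eq_norm]
    refine (norm_oscIntegral_sub_le hlam hp.1 hp.2.1 hp.2.2 hR1).trans_lt ?_
    rw [div_lt_iff₀ (by linarith)]
    rw [div_lt_iff₀ he] at hR2
    linarith
  refine hu.continuousOn (Eventually.of_forall fun R => Continuous.continuousOn ?_).frequently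
  exact intervalIntegral.continuous_parametric_intervalIntegral_of_continuous'
    (f := fun (p : ℝ × ℝ) (z : ℝ) => osc lam p.1 p.2 z) (continuous_osc lam) (-R) R

theorem osc_zero (lam : ℂ) (s z : ℝ) :
    osc lam s 0 z = Complex.exp (-Complex.I * ((z : ℂ) ^ 3 / 3 + s * z)) := by
  have hp : phase s 0 z = -(s * z + z ^ 3 / 3) := by
    simp only [phase, zero_pow two_ne_zero, zero_mul, add_zero, div_one, integral_pow]
    norm_num
  rw [osc, hp, amp]
  simp only [zero_pow two_ne_zero, zero_mul, add_zero, Complex.ofReal_one, Complex.one_cpow, mul_one]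
  congr 1
  push_cast
  ring

theorem oscIntegral_zero_ne_zero {lam : ℂ} (hlam : lam.re = 0) {s : ℝ} (hs : 0 ≤ s) :
    oscIntegral lam s 0 ≠ 0 := by
  have ht := (tendsto_oscIntegral hlam hs le_rfl zero_le_one).comp tendsto_neg_id_atBot_prod_atTop
  simp only [osc_zero, Function.comp_def] at ht
  exact airyIntegral_limit_ne_zero hs ht

/-- For bounded `s` and small `h` the integral of `osc` is bounded away from zero. -/
theorem exists_le_norm_oscIntegral {lam : ℂ} (hlam : lam.re = 0) (S : ℝ) :
    ∃ c > 0, ∃ δ > 0, ∀ s ∈ Set.Icc 0 S, ∀ h ∈ Set.Ico 0 δ, h ≤ 1 → c ≤ ‖oscIntegral lam s h‖ := by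
  rcases lt_or_ge S 0 with hS | hS
  · exact ⟨1, one_pos, 1, one_pos, fun s hs => absurd (hs.1.trans hs.2) (not_le.2 hS)⟩
  have hcont := (continuousOn_oscIntegral hlam).norm
  have hK : IsCompact (Set.Icc 0 S) := isCompact_Icc
  have hslice : ContinuousOn (fun s : ℝ => ‖oscIntegral lam s 0‖) (Set.Icc 0 S) :=
    hcont.comp (f := fun s : ℝ => (s, (0 : ℝ))) (by fun_prop) fun s hs => ⟨hs.1, by simp⟩
  obtain ⟨s₀, hs₀, hmin⟩ := hK.exists_isMinOn ⟨0, le_rfl, hS⟩ hslice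
  have hpos : 0 < ‖oscIntegral lam s₀ 0‖ := norm_pos_iff.2 (oscIntegral_zero_ne_zero hlam hs₀.1)
  -- Half the minimum over the slice `h = 0` remains a lower bound near each `(s, 0)`; compactness
  -- in `s` gives one `δ` for all.
  have hev := hK.eventually_forall_of_forall_eventually (x₀ := (0 : ℝ))
    (P := fun h s => 0 ≤ s → h ∈ Set.Icc (0 : ℝ) 1 →
      ‖oscIntegral lam s₀ 0‖ / 2 ≤ ‖oscIntegral lam s h‖) (by
    intro s hs
    have hlt : ‖oscIntegral lam s₀ 0‖ / 2 < ‖oscIntegral lam s 0‖ :=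
      (half_lt_self hpos).trans_le (hmin hs)
    have h1 := (hcont (s, 0) ⟨hs.1, by simp⟩).eventually (lt_mem_nhds hlt)
    rw [eventually_nhdsWithin_iff] at h1
    have h2 := (continuous_swap.tendsto ((0 : ℝ), s)).eventually h1
    filter_upwards [h2] with z hz hz1 hz2
    exact (hz ⟨hz1, hz2⟩).le)
  obtain ⟨δ, hδ, hball⟩ := Metric.eventually_nhds_iff.1 hev
  refine ⟨_, half_pos hpos, δ, hδ, fun s hs h hh h1 => ?_⟩
  refine hball ?_ s hs hs.1 ⟨hh.1, h1⟩
  rw [Real.dist_eq, sub_zero, abs_of_nonneg hh.1]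
  exact hh.2

theorem phase_of_pos (s : ℝ) {h : ℝ} (hh : 0 < h) (z : ℝ) :
    phase s h z = (Real.arctan (h * z) - h * z) / h ^ 3 - s * z := by
  have hd : ∀ w : ℝ, HasDerivAt (fun w => (h * w - Real.arctan (h * w)) / h ^ 3)
      (w ^ 2 / (1 + h ^ 2 * w ^ 2)) w := by
    intro w
    have hl : HasDerivAt (fun w : ℝ => h * w) h w := by
      simpa using (hasDerivAt_id w).const_mul h
    refine ((hl.sub hl.arctan).div_const (h ^ 3)).congr_deriv ?_
    have := (one_add_sq_mul_sq_pos h w).ne'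
    rw [mul_pow]
    field_simp
    ring
  have hc : Continuous fun w : ℝ => w ^ 2 / (1 + h ^ 2 * w ^ 2) :=
    Continuous.div (by fun_prop) (by fun_prop) fun q => (one_add_sq_mul_sq_pos _ _).ne'
  rw [phase, intervalIntegral.integral_eq_sub_of_hasDerivAt (fun w _ => hd w)
    (hc.intervalIntegrable 0 z)]
  simp only [mul_zero, Real.arctan_zero]
  ring

/-! ### Reduction of the Whittaker integral to `oscIntegral` -/

namespace PrincipalSeries

/-- The inverse of `[a]` sends `(x, 1)` to `(x / a, a)`, off the horizontal axis, so the limit in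
`homExtend` plays no role and `v` may be arbitrary; this covers odd `m`. -/
theorem lineAction_diagElement (lam : ℂ) {a : ℝ} (ha : 0 < a) (v : ℝ → ℂ) (x : ℝ) :
    lineAction lam (diagElement a ha.ne') v x = (a : ℂ) ^ (lam - 1) * v (x / a ^ 2) := by
  have hdet : ((diagElement a ha.ne' : GL (Fin 2) ℝ) : Matrix (Fin 2) (Fin 2) ℝ).det = 1 := by
    simp [diagElement, Matrix.det_fin_two, ha.ne']
  have hval : ((diagElement a ha.ne' : GL (Fin 2) ℝ) : Matrix (Fin 2) (Fin 2) ℝ) =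
      !![a, 0; 0, a⁻¹] := rfl
  have hinv : (((diagElement a ha.ne')⁻¹ : GL (Fin 2) ℝ) : Matrix (Fin 2) (Fin 2) ℝ) =
      !![a⁻¹, 0; 0, a] := by
    rw [Matrix.coe_units_inv, hval]
    refine Matrix.inv_eq_left_inv ?_
    ext i j
    fin_cases i <;> fin_cases j <;> simp [ha.ne']
  have hmul : (!![a⁻¹, 0; 0, a] : Matrix (Fin 2) (Fin 2) ℝ).mulVec ![x, 1] = ![a⁻¹ * x, a] := by
    ext i
    fin_cases i <;> simp [Matrix.mulVec, dotProduct, Fin.sum_univ_two]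
  have hx : a⁻¹ * x / a = x / a ^ 2 := by field_simp
  simp only [lineAction, restrictLine, planeAction, hdet, hinv, hmul, homExtend]
  simp [ha.ne', abs_of_pos ha, hx]

/-- The Whittaker integrand of `π([a]) e_m` in the variable `x = a² h z`. -/
theorem lineAction_kType_mul_psi_eq_osc (lam : ℂ) {m : ℤ} {n a h s : ℝ} (ha : 0 < a) (hh : 0 < h)
    (hm : (m : ℝ) * h ^ 3 = 1) (hs : s = (n * a ^ 2 - m) * h) (z : ℝ) :
    lineAction lam (diagElement a ha.ne') (kType lam m) (a ^ 2 * h * z) *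
      (starRingEnd ℂ) (psi n (a ^ 2 * h * z)) = (a : ℂ) ^ (lam - 1) * osc lam s h z := by
  have hx : a ^ 2 * h * z / a ^ 2 = h * z := by field_simp
  have hphase : phase s h z = m * Real.arctan (h * z) - n * (a ^ 2 * h * z) := by
    have hm' : (m : ℝ) = 1 / h ^ 3 := by field_simp; exact hm
    rw [phase_of_pos s hh, hs, hm']
    ring
  rw [lineAction_diagElement lam ha, hx, kType, psi, ← Complex.exp_conj, osc, amp, hphase, mul_pow,
    mul_assoc, mul_assoc, mul_comm (((1 + h ^ 2 * z ^ 2 : ℝ) : ℂ) ^ ((lam - 1) / 2)), ← mul_assoc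
    (Complex.exp _), ← Complex.exp_add]
  congr 3
  simp only [map_mul, Complex.conj_I, Complex.conj_ofReal]
  push_cast
  ring

theorem whittakerTrunc_lineAction_kType (lam : ℂ) {m : ℤ} {n a h s : ℝ} (ha : 0 < a) (hh : 0 < h)
    (hm : (m : ℝ) * h ^ 3 = 1) (hs : s = (n * a ^ 2 - m) * h) (p q : ℝ) :
    whittakerTrunc n (lineAction lam (diagElement a ha.ne') (kType lam m)) p q =
      ((Real.pi : ℂ)⁻¹ * ((a ^ 2 * h : ℝ) : ℂ) * (a : ℂ) ^ (lam - 1)) *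
        ∫ z in (p / (a ^ 2 * h))..(q / (a ^ 2 * h)), osc lam s h z := by
  have hk : 0 < a ^ 2 * h := by positivity
  have hsub := intervalIntegral.smul_integral_comp_mul_left (a := p / (a ^ 2 * h))
    (b := q / (a ^ 2 * h)) (fun x => lineAction lam (diagElement a ha.ne') (kType lam m) x *
      (starRingEnd ℂ) (psi n x)) (a ^ 2 * h)
  rw [mul_div_cancel₀ _ hk.ne', mul_div_cancel₀ _ hk.ne'] at hsub
  rw [whittakerTrunc, ← hsub]
  simp only [lineAction_kType_mul_psi_eq_osc lam ha hh hm hs]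
  rw [intervalIntegral.integral_const_mul, Complex.real_smul]
  ring

theorem tendsto_whittakerTrunc_lineAction_kType {lam : ℂ} (hlam : lam.re = 0) {m : ℤ}
    {n a h s : ℝ} (ha : 0 < a) (hh : 0 < h) (h1 : h ≤ 1) (hm : (m : ℝ) * h ^ 3 = 1)
    (hs : s = (n * a ^ 2 - m) * h) (hs0 : 0 ≤ s) :
    Tendsto (fun p : ℝ × ℝ =>
        whittakerTrunc n (lineAction lam (diagElement a ha.ne') (kType lam m)) p.1 p.2)
      (atBot ×ˢ atTop) (𝓝 (((Real.pi : ℂ)⁻¹ * ((a ^ 2 * h : ℝ) : ℂ) * (a : ℂ) ^ (lam - 1)) *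
        oscIntegral lam s h)) := by
  have hk : 0 < a ^ 2 * h := by positivity
  have hsc : Tendsto (fun p : ℝ × ℝ => (p.1 / (a ^ 2 * h), p.2 / (a ^ 2 * h)))
      (atBot ×ˢ atTop) (atBot ×ˢ atTop) :=
    (tendsto_id.atBot_div_const hk).prodMap (tendsto_id.atTop_div_const hk)
  have := ((tendsto_oscIntegral hlam hs0 hh.le h1).comp hsc).const_mul
    ((Real.pi : ℂ)⁻¹ * ((a ^ 2 * h : ℝ) : ℂ) * (a : ℂ) ^ (lam - 1))
  refine this.congr fun p => ?_
  rw [whittakerTrunc_lineAction_kType lam ha hh hm hs]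
  rfl

/-- The Jacobian `a² h` meets `|a^(lam - 1)| = a⁻¹`, leaving `a h`. -/
theorem norm_whittaker_lineAction_kType {lam : ℂ} (hlam : lam.re = 0) {m : ℤ}
    {n a h s : ℝ} (ha : 0 < a) (hh : 0 < h) (h1 : h ≤ 1) (hm : (m : ℝ) * h ^ 3 = 1)
    (hs : s = (n * a ^ 2 - m) * h) (hs0 : 0 ≤ s) :
    ‖whittaker n (lineAction lam (diagElement a ha.ne') (kType lam m))‖ =
      Real.pi⁻¹ * a * h * ‖oscIntegral lam s h‖ := by
  rw [whittaker, (tendsto_whittakerTrunc_lineAction_kType hlam ha hh h1 hm hs hs0).limUnder_eq,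
    norm_mul, norm_mul, norm_mul, norm_inv, Complex.norm_real, Complex.norm_real,
    Complex.norm_cpow_eq_rpow_re_of_pos ha, Real.norm_of_nonneg Real.pi_pos.le,
    Real.norm_of_nonneg (by positivity)]
  have : a ^ (lam - 1).re = a⁻¹ := by
    rw [Complex.sub_re, hlam, Complex.one_re, zero_sub, Real.rpow_neg_one]
  rw [this]
  field_simp

end PrincipalSeries

/-! ### Choice of scale and conclusion -/

theorem mainTheorem6 (lam : ℂ) (hlam : lam.re = 0) :
    ∃ C : ℝ, 0 < C ∧ ∃ M : ℝ, ∀ m : ℤ, 0 < m → M ≤ (m : ℝ) →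
      ∀ (n a : ℝ) (_ : 0 < n) (ha : 0 < a), a ≤ 1 →
      ∀ β ε : ℝ, β = Real.sqrt ((m : ℝ) / n) → ε = a / β - 1 → β ≤ 1 →
        0 ≤ ε → ε ≤ (n * β ^ 2) ^ (-(2 / 3) : ℝ) → (n * β ^ 2) ^ (-(2 / 3) : ℝ) ≤ 1 / 2 →
        PrincipalSeries.WhittakerConverges n
            (PrincipalSeries.lineAction lam (PrincipalSeries.diagElement a ha.ne')
              (PrincipalSeries.kType lam m)) ∧
          C * n ^ (-(2 / 3) : ℝ) * β ^ (2 / 3 : ℝ) ≤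
            ‖PrincipalSeries.whittaker n
              (PrincipalSeries.lineAction lam (PrincipalSeries.diagElement a ha.ne')
                (PrincipalSeries.kType lam m))‖ ^ 2 := by
  obtain ⟨c, hc, δ, hδ, hbound⟩ := exists_le_norm_oscIntegral hlam 3
  -- `m ≥ (2 / δ)³` means `h = m^(-1/3) ≤ δ / 2`, strictly inside the range of `hbound`.
  refine ⟨(Real.pi⁻¹ * c) ^ 2, by positivity, (δ / 2)⁻¹ ^ 3, ?_⟩
  intro m hm0 hM n a hn ha _ β ε hβ hε _ hε0 hε1 hhalf
  have hm1 : (1 : ℝ) ≤ m := by exact_mod_cast hm0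
  have hmpos : (0 : ℝ) < m := by linarith
  have hβpos : 0 < β := hβ ▸ Real.sqrt_pos.2 (by positivity)
  have hβsq : n * β ^ 2 = m := by
    rw [hβ, Real.sq_sqrt (by positivity), mul_div_cancel₀ _ hn.ne']
  rw [hβsq] at hε1 hhalf
  have haβ : a = β * (1 + ε) := by
    rw [hε]
    field_simp
    ring
  set h : ℝ := (m : ℝ) ^ (-(1 / 3) : ℝ) with hh
  have hhpos : 0 < h := Real.rpow_pos_of_pos hmpos _
  have hh1 : h ≤ 1 := Real.rpow_le_one_of_one_le_of_nonpos hm1 (by norm_num)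
  have hh3 : (m : ℝ) * h ^ 3 = 1 := by
    rw [hh, ← Real.rpow_natCast, ← Real.rpow_mul hmpos.le]
    norm_num
    rw [Real.rpow_neg_one, mul_inv_cancel₀ hmpos.ne']
  have hh2 : (m : ℝ) ^ (-(2 / 3) : ℝ) = h ^ 2 := by
    rw [hh, ← Real.rpow_natCast, ← Real.rpow_mul hmpos.le]
    norm_num
  rw [hh2] at hε1 hhalf
  have hhδ : h < δ := by
    by_contra! hle
    have h2 : (δ / 2)⁻¹ ^ 3 * h ^ 3 ≤ 1 := hh3 ▸ by gcongr
    rw [← mul_pow] at h2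
    have h3 : 2 ≤ (δ / 2)⁻¹ * h := by
      rw [inv_mul_eq_div, le_div_iff₀ (by positivity)]
      linarith
    have h4 : (2 : ℝ) ^ 3 ≤ ((δ / 2)⁻¹ * h) ^ 3 := by gcongr
    linarith
  set s : ℝ := (n * a ^ 2 - m) * h with hs
  have hsval : s = m * h * (ε * (2 + ε)) := by
    rw [hs, haβ, ← hβsq]
    ring
  have hs0 : 0 ≤ s := by rw [hsval]; positivity
  -- From `ε ≤ h²`, `ε ≤ 1` and `m h³ = 1`; this is the `3` given to `exists_le_norm_oscIntegral`.
  have hs3 : s ≤ 3 := by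
    have h1 : m * h * (ε * (2 + ε)) ≤ m * h * (h ^ 2 * (2 + 1)) := by
      gcongr
      linarith
    have h2 : m * h * (h ^ 2 * (2 + 1)) = 3 * (m * h ^ 3) := by ring
    rw [hsval]
    linarith
  refine ⟨⟨_, PrincipalSeries.tendsto_whittakerTrunc_lineAction_kType hlam ha hhpos hh1 hh3 hs hs0⟩,
    ?_⟩
  rw [PrincipalSeries.norm_whittaker_lineAction_kType hlam ha hhpos hh1 hh3 hs hs0]
  have hF := hbound s ⟨hs0, hs3⟩ h ⟨hhpos.le, hhδ⟩ hh1
  -- Here `h² = m^(-2/3) = (n β²)^(-2/3)`, and `2 - 4/3 = 2/3`.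
  have hpow : n ^ (-(2 / 3) : ℝ) * β ^ (2 / 3 : ℝ) = β ^ 2 * h ^ 2 := by
    rw [← hh2, ← hβsq, Real.mul_rpow hn.le (by positivity), ← Real.rpow_natCast β 2,
      ← Real.rpow_mul hβpos.le, mul_left_comm, ← Real.rpow_add hβpos]
    norm_num
  rw [mul_assoc, hpow]
  have hβa : β ≤ a := by
    rw [haβ]
    nlinarith
  calc (Real.pi⁻¹ * c) ^ 2 * (β ^ 2 * h ^ 2) = (Real.pi⁻¹ * β * h * c) ^ 2 := by ring
    _ ≤ (Real.pi⁻¹ * a * h * ‖oscIntegral lam s h‖) ^ 2 := by gcongr
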